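/- Let $2\le k\le n$ be integers. For $\gamma\in\mathbb R^n$ let $\sigma_j(\gamma)=\sum_{i_1<\dots<i_j}\gamma_{i_1}\cdots\gamma_{i_j}$ be the $j$-th elementary symmetric polynomial, and let $\sigma_{k-1,i}(\gamma)$ be $\sigma_{k-1}$ evaluated at $\gamma$ with its $i$-th entry replaced by $0$. Let $\Gamma_k=\{\gamma\in\mathbb R^n:\sigma_j(\gamma)>0 \text{ for } j=1,\dots,k\}$, and let $\overline\Gamma_k$ be its closure in $\mathbb R^n$. For a real symmetric $n\times n$ matrix $M$ let $\lambda(M)=(\lambda_1(M),\dots,\lambda_n(M))$ be its eigenvalues with multiplicity (the order plays no role below). Let $\mathcal A_k$ be the set of real symmetric positive semidefinite $n\times n$ matrices $A$ for which there is $\gamma\in\Gamma_k$ with $\sigma_k(\gamma)=1$ and $\lambda_i(A)^2=\sigma_{k-1,i}(\gamma)$ for $i=1,\dots,n$. Then, for every real symmetric $n\times n$ matrix $M$, $$\inf_{A\in\mathcal A_k}\operatorname{tr}(A^tMA)=\begin{cases}k\,\sigma_k(\lambda(M))^{1/k}&\text{if }\lambda(M)\in\overline\Gamma_k,\\-\infty&\text{otherwise.}\end{cases}$$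 Consequently, the set of real symmetric matrices $M$ with $\inf_{A\in\mathcal A_k}\operatorname{tr}(A^tMA)>-\infty$ is exactly the set of those with $\lambda(M)\in\overline\Gamma_k$; and for every open $\Omega\subseteq\mathbb R^n$ and every $u\in C^2(\Omega)$, $u$ is $k$-convex (that is, $\sigma_j(\lambda(D^2u(x)))\ge0$ for all $j=1,\dots,k$ and all $x\in\Omega$) if and only if $u$ is $\mathcal A_k$-admissible (that is, $\inf_{A\in\mathcal A_k}\operatorname{tr}(A^tD^2u(x)A)>-\infty$ for all $x\in\Omega$). -/

import Mathlib

noncomputable section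

namespace KHessian

/-- The `k`-th elementary symmetric function of `γ ∈ ℝⁿ`. -/
def sigma {n : ℕ} (k : ℕ) (γ : Fin n → ℝ) : ℝ :=
  MvPolynomial.eval γ (MvPolynomial.esymm (Fin n) ℝ k)

/-- `σ_{k,i}(γ)`: the `k`-th elementary symmetric function of `γ` with its `i`-th entry
replaced by `0`. -/
def sigmaOmit {n : ℕ} (k : ℕ) (i : Fin n) (γ : Fin n → ℝ) : ℝ :=
  sigma k (Function.update γ i 0)

/-- The open Gårding cone `Γ_k ⊆ ℝⁿ`. -/
def gardingCone (n k : ℕ) : Set (Fin n → ℝ) :=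
  {γ | ∀ j : ℕ, 1 ≤ j → j ≤ k → 0 < sigma j γ}

/-- The real symmetric matrices whose eigenvalue vector (counted with multiplicity) lies in the
closed Gårding cone, the topological closure of `Γ_k`. Over `ℝ`, Hermitian means symmetric. The
cone is invariant under permutations, so the order of the eigenvalues is immaterial. -/
def closedConeMat (n k : ℕ) : Set (Matrix (Fin n) (Fin n) ℝ) :=
  {M | ∃ hM : M.IsHermitian, hM.eigenvalues ∈ closure (gardingCone n k)}

/-- The set `𝒜_k` of symmetric positive semidefinite matrices `A` with
`λ_i(A)² = σ_{k-1,i}(γ)` for all `i`, for some `γ ∈ Γ_k` with `σ_k(γ) = 1`. Permuting `γ` permutes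
the numbers `σ_{k-1,i}(γ)`, so the order of the eigenvalues is immaterial. -/
def coeffSet (n k : ℕ) : Set (Matrix (Fin n) (Fin n) ℝ) :=
  {A | ∃ hA : A.PosSemidef, ∃ γ ∈ gardingCone n k, sigma k γ = 1 ∧
    ∀ i, hA.isHermitian.eigenvalues i ^ 2 = sigmaOmit (k - 1) i γ}

/-- `F(M) = inf_{A ∈ 𝒜} tr(Aᵗ M A)`, an infimum in the extended reals. -/
def infOp {n : ℕ} (𝒜 : Set (Matrix (Fin n) (Fin n) ℝ)) (M : Matrix (Fin n) (Fin n) ℝ) : EReal :=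
  ⨅ A ∈ 𝒜, ((A.transpose * M * A).trace : EReal)

/-- `Γ_𝒜 = {M symmetric : F(M) > -∞}`. -/
def finiteCone {n : ℕ} (𝒜 : Set (Matrix (Fin n) (Fin n) ℝ)) : Set (Matrix (Fin n) (Fin n) ℝ) :=
  {M | M.IsHermitian ∧ ⊥ < infOp 𝒜 M}

/-- The Hessian matrix `D²u(x)`, with entries the second partial derivatives. -/
def hessian {n : ℕ} (u : EuclideanSpace ℝ (Fin n) → ℝ) (x : EuclideanSpace ℝ (Fin n)) :
    Matrix (Fin n) (Fin n) ℝ :=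
  Matrix.of fun i j =>
    iteratedFDeriv ℝ 2 u x ![EuclideanSpace.single i 1, EuclideanSpace.single j 1]

/-- `u` is `𝒜`-admissible in `Ω`. -/
def Admissible {n : ℕ} (𝒜 : Set (Matrix (Fin n) (Fin n) ℝ))
    (Ω : Set (EuclideanSpace ℝ (Fin n))) (u : EuclideanSpace ℝ (Fin n) → ℝ) : Prop :=
  ∀ x ∈ Ω, hessian u x ∈ finiteCone 𝒜

/-- `u` is `k`-convex in `Ω`: `σ_j(λ(D²u(x))) ≥ 0` for `j = 1, …, k` and all `x ∈ Ω`. (The Hessian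
of a `C²` function on an open set is symmetric.) -/
def KConvex {n : ℕ} (k : ℕ) (Ω : Set (EuclideanSpace ℝ (Fin n)))
    (u : EuclideanSpace ℝ (Fin n) → ℝ) : Prop :=
  ∀ x ∈ Ω, ∃ h : (hessian u x).IsHermitian,
    ∀ j : ℕ, 1 ≤ j → j ≤ k → 0 ≤ sigma j h.eigenvalues

end KHessian

end

/-! Write `tr(AᵗMA) = tr(MA²) = ∑ P i j * λ_i(M) * λ_j(A)²` with `P` the squared entries of an
orthogonal matrix, hence doubly stochastic. By Birkhoff's theorem the least value over `P` occurs at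
a permutation, and permuting `γ` preserves the constraints; so the infimum is that of `∑ λ_i(M)
σ_{k-1,i}(γ)`, the derivative of `σ_k` at `γ` in the direction `λ(M)`.

On the closed cone, Gårding's inequality (`garding`) bounds this below by `k σ_k(λ)^{1/k}`, and
normalising `λ + ε(1,…,1)` gives `γ` approaching the bound (`exists_sum_lt_of_mem`). Gårding's
inequality comes from superadditivity of the ratios `σ_{j+1}/σ_j` (Marcus–Lopes): their product is
`σ_k`, and AM–GM finishes.

Off the cone, some boundary point `x` has negative pairing with `λ` (`exists_boundary_separating`).
Pushing `x` inward by `ε(1,…,1)` and rescaling to `σ_k = 1` multiplies the pairing by the `(k-1)`-st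
power of a factor tending to infinity, so it tends to `-∞` because `k ≥ 2`. -/

namespace KHessian

section

open Finset Polynomial

/-- The elementary symmetric function of degree `k` in the variables `x i`, `i ∈ s`. -/
def elem {ι : Type*} (s : Finset ι) (x : ι → ℝ) (k : ℕ) : ℝ :=
  ∑ t ∈ s.powersetCard k, ∏ i ∈ t, x i

/-! ### Recursions and derivatives of elementary symmetric functions -/

section Elem

variable {ι : Type*}

@[simp] lemma elem_zero (s : Finset ι) (x : ι → ℝ) : elem s x 0 = 1 := by
  simp [elem]

lemma elem_of_card_lt {s : Finset ι} {k : ℕ} (x : ι → ℝ) (h : s.card < k) : elem s x k = 0 := by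
  simp [elem, Finset.powersetCard_eq_empty.2 h]

@[simp] lemma elem_empty_succ (x : ι → ℝ) (k : ℕ) : elem ∅ x (k + 1) = 0 :=
  elem_of_card_lt x (by simp)

lemma elem_one (s : Finset ι) (x : ι → ℝ) : elem s x 1 = ∑ i ∈ s, x i := by
  simp [elem, Finset.powersetCard_one]

lemma elem_smul (s : Finset ι) (c : ℝ) (x : ι → ℝ) (k : ℕ) :
    elem s (c • x) k = c ^ k * elem s x k := by
  unfold elem
  rw [Finset.mul_sum]
  refine Finset.sum_congr rfl fun t ht => ?_
  simp [Finset.prod_mul_distrib, (Finset.mem_powersetCard.1 ht).2]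

lemma elem_map {κ : Type*} (f : κ ↪ ι) (s : Finset κ) (x : ι → ℝ) (k : ℕ) :
    elem (s.map f) x k = elem s (x ∘ f) k := by
  simp [elem, Finset.powersetCard_map, Finset.sum_map]

lemma continuous_elem (s : Finset ι) (k : ℕ) : Continuous fun x : ι → ℝ => elem s x k := by
  unfold elem
  fun_prop

variable [DecidableEq ι]

lemma elem_insert {s : Finset ι} {a : ι} (ha : a ∉ s) (x : ι → ℝ) (k : ℕ) :
    elem (insert a s) x (k + 1) = elem s x (k + 1) + x a * elem s x k := by
  unfold elem
  rw [Finset.powersetCard_succ_insert ha, Finset.sum_union, Finset.sum_image, Finset.mul_sum]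
  · congr 1
    refine Finset.sum_congr rfl fun t ht => ?_
    rw [Finset.prod_insert fun h => ha ((Finset.mem_powersetCard.1 ht).1 h)]
  · intro t ht u hu h
    have h1 : a ∉ t := fun h => ha ((Finset.mem_powersetCard.1 ht).1 h)
    have h2 : a ∉ u := fun h => ha ((Finset.mem_powersetCard.1 hu).1 h)
    rw [← Finset.erase_insert h1, h, Finset.erase_insert h2]
  · rw [Finset.disjoint_left]
    intro t ht hu
    obtain ⟨u, -, rfl⟩ := Finset.mem_image.1 hu
    exact ha ((Finset.mem_powersetCard.1 ht).1 (Finset.mem_insert_self a u))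

lemma elem_erase {s : Finset ι} {a : ι} (ha : a ∈ s) (x : ι → ℝ) (k : ℕ) :
    elem s x (k + 1) = elem (s.erase a) x (k + 1) + x a * elem (s.erase a) x k := by
  conv_lhs => rw [← Finset.insert_erase ha]
  exact elem_insert (Finset.notMem_erase a s) x k

lemma sum_mul_elem_erase (s : Finset ι) (x : ι → ℝ) (k : ℕ) :
    ∑ i ∈ s, x i * elem (s.erase i) x k = (k + 1) * elem s x (k + 1) := by
  induction s using Finset.induction_on generalizing k with
  | empty => simp
  | insert a s ha ih =>
    rw [Finset.sum_insert ha, Finset.erase_insert ha, elem_insert ha]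
    have key : ∀ i ∈ s, (insert a s).erase i = insert a (s.erase i) := fun i hi =>
      Finset.erase_insert_of_ne fun h => ha (h ▸ hi)
    cases k with
    | zero =>
      simp [elem_one]
      ring
    | succ k =>
      have : ∑ i ∈ s, x i * elem ((insert a s).erase i) x (k + 1) =
          ∑ i ∈ s, x i * elem (s.erase i) x (k + 1) +
            x a * ∑ i ∈ s, x i * elem (s.erase i) x k := by
        rw [Finset.mul_sum, ← Finset.sum_add_distrib]
        refine Finset.sum_congr rfl fun i hi => ?_
        rw [key i hi, elem_insert fun h => ha (Finset.mem_of_mem_erase h)]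
        ring
      rw [this, ih, ih]
      push_cast
      ring

lemma sum_elem_erase (s : Finset ι) (x : ι → ℝ) (k : ℕ) :
    ∑ i ∈ s, elem (s.erase i) x k = (s.card - k) * elem s x k := by
  cases k with
  | zero => simp
  | succ k =>
    have : ∑ i ∈ s, elem (s.erase i) x (k + 1) =
        ∑ i ∈ s, (elem s x (k + 1) - x i * elem (s.erase i) x k) :=
      Finset.sum_congr rfl fun i hi => by rw [elem_erase hi]; ring
    rw [this, Finset.sum_sub_distrib, sum_mul_elem_erase]
    simp
    ring

/-- This identifies the pairing in the trace formula as a directional derivative. The function is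
affine in each variable, with slope the function of the remaining ones. -/
lemma hasDerivAt_elem (s : Finset ι) (x y : ι → ℝ) (k : ℕ) (t : ℝ) :
    HasDerivAt (fun t : ℝ => elem s (x + t • y) (k + 1))
      (∑ i ∈ s, y i * elem (s.erase i) (x + t • y) k) t := by
  induction s using Finset.induction_on generalizing k with
  | empty => simpa using hasDerivAt_const t (0 : ℝ)
  | insert a s ha ih =>
    have hlin : HasDerivAt (fun t : ℝ => (x + t • y) a) (y a) t := by
      simpa using ((hasDerivAt_id t).mul_const (y a)).const_add (x a)
    have key : ∀ i ∈ s, (insert a s).erase i = insert a (s.erase i) := fun i hi =>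
      Finset.erase_insert_of_ne fun h => ha (h ▸ hi)
    simp only [elem_insert ha]
    rw [Finset.sum_insert ha, Finset.erase_insert ha]
    cases k with
    | zero =>
      simp only [elem_zero, mul_one] at ih ⊢
      exact ((ih 0).add hlin).congr_deriv (by simp; ring)
    | succ k =>
      refine ((ih (k + 1)).add (hlin.mul (ih k))).congr_deriv ?_
      have : ∑ i ∈ s, y i * elem ((insert a s).erase i) (x + t • y) (k + 1) =
          ∑ i ∈ s, y i * elem (s.erase i) (x + t • y) (k + 1) +
            (x + t • y) a * ∑ i ∈ s, y i * elem (s.erase i) (x + t • y) k := by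
        rw [Finset.mul_sum, ← Finset.sum_add_distrib]
        refine Finset.sum_congr rfl fun i hi => ?_
        rw [key i hi, elem_insert fun h => ha (Finset.mem_of_mem_erase h)]
        ring
      rw [this]
      ring

end Elem

/-! ### Newton's inequality through real-rooted polynomials -/

section Newton

/-- Rolle: differentiation lowers the number of roots, with multiplicity, by at most one, as much as
the degree drops. -/
lemma splits_derivative {p : ℝ[X]} (hp : p.Splits) : (derivative p).Splits := by
  rw [splits_iff_card_roots] at hp ⊢
  have h1 := card_roots_le_derivative p
  have h2 := natDegree_derivative_le p
  have h3 := card_roots' (derivative p)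
  omega

lemma splits_iterate_derivative {p : ℝ[X]} (hp : p.Splits) (m : ℕ) :
    (derivative^[m] p).Splits := by
  induction m with
  | zero => exact hp
  | succ m ih =>
    rw [Function.iterate_succ_apply']
    exact splits_derivative ih

/-- Laguerre's inequality at the origin. -/
lemma two_mul_coeff_le_sq {p : ℝ[X]} (hp : p.Splits) :
    2 * (p.coeff 0 * p.coeff 2) ≤ p.coeff 1 ^ 2 := by
  have key : ∀ s : Multiset ℝ, 2 * (((s.map fun a => X - C a).prod).coeff 0 *
      ((s.map fun a => X - C a).prod).coeff 2) ≤ ((s.map fun a => X - C a).prod).coeff 1 ^ 2 := by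
    intro s
    induction s using Multiset.induction_on with
    | empty => simp [coeff_one]
    | cons a s ih =>
      simp only [Multiset.map_cons, Multiset.prod_cons]
      set q := (s.map fun a => X - C a).prod
      simp only [sub_mul, coeff_sub, coeff_C_mul, coeff_X_mul_zero]
      have h1 : (X * q).coeff 1 = q.coeff 0 := coeff_X_mul q 0
      have h2 : (X * q).coeff 2 = q.coeff 1 := coeff_X_mul q 1
      rw [h1, h2]
      -- A factor `X - a` turns the defect `D = c₁² - 2c₀c₂` into `c₀² + a²D`.
      nlinarith [sq_nonneg (q.coeff 0), mul_le_mul_of_nonneg_left ih (sq_nonneg a)]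
  rw [hp.eq_prod_roots]
  simp only [coeff_C_mul]
  nlinarith [mul_le_mul_of_nonneg_left (key p.roots) (sq_nonneg p.leadingCoeff)]

/-- A form of **Newton's inequality**. -/
lemma coeff_mul_coeff_le_sq {p : ℝ[X]} (hp : p.Splits) (m : ℕ) :
    p.coeff m * p.coeff (m + 2) ≤ p.coeff (m + 1) ^ 2 := by
  have h := two_mul_coeff_le_sq (splits_iterate_derivative hp m)
  simp only [coeff_iterate_derivative, nsmul_eq_mul, Nat.zero_add] at h
  rw [Nat.add_comm 2 m, Nat.add_comm 1 m] at h
  have e0 : (m.descFactorial m : ℝ) = m.factorial := by rw [Nat.descFactorial_self]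
  have e1 : ((m + 1).descFactorial m : ℝ) = (m + 1) * m.factorial := by
    have := Nat.factorial_mul_descFactorial (show m ≤ m + 1 by omega)
    simp [Nat.factorial_succ] at this
    exact_mod_cast this
  have e2 : 2 * ((m + 2).descFactorial m : ℝ) = (m + 2) * ((m + 1) * m.factorial) := by
    have := Nat.factorial_mul_descFactorial (show m ≤ m + 2 by omega)
    simp [Nat.factorial_succ] at this
    have h2 : (2 : ℝ) * ((m + 2).descFactorial m : ℝ) =
      ((2 * (m + 2).descFactorial m : ℕ) : ℝ) := by push_cast; ring
    rw [h2, this]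
    push_cast
    ring
  rw [e0, e1] at h
  have hf : (0 : ℝ) < m.factorial := by exact_mod_cast m.factorial_pos
  have h' : (m.factorial : ℝ) ^ 2 * (m + 1) * ((m + 2) * (p.coeff m * p.coeff (m + 2))) ≤
      (m.factorial : ℝ) ^ 2 * (m + 1) * ((m + 1) * p.coeff (m + 1) ^ 2) := by
    calc _ = (m.factorial : ℝ) * p.coeff m *
          ((m + 2) * ((m + 1) * m.factorial) * p.coeff (m + 2)) := by ring
      _ = 2 * (m.factorial * p.coeff m * ((m + 2).descFactorial m * p.coeff (m + 2))) := by
          rw [← e2]; ring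
      _ ≤ _ := h
      _ = _ := by ring
  have h'' := le_of_mul_le_mul_left h' (by positivity)
  -- Now `(m+2) c_m c_{m+2} ≤ (m+1) c_{m+1}²`; the constants may be dropped when the product is
  -- nonnegative, and otherwise the claim is trivial.
  by_cases hs : 0 ≤ p.coeff m * p.coeff (m + 2)
  · have hm : (0 : ℝ) ≤ m := m.cast_nonneg
    nlinarith
  · nlinarith [sq_nonneg (p.coeff (m + 1))]

lemma elem_mul_elem_le_sq {ι : Type*} (s : Finset ι) (x : ι → ℝ) (j : ℕ) :
    elem s x j * elem s x (j + 2) ≤ elem s x (j + 1) ^ 2 := by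
  by_cases hj : j + 2 ≤ s.card
  · have hsp : (∏ i ∈ s, (X + C (x i))).Splits :=
      Splits.prod fun i _ => Splits.X_add_C (x i)
    have hc : ∀ m ≤ s.card, (∏ i ∈ s, (X + C (x i))).coeff m = elem s x (s.card - m) :=
      fun m hm => Finset.prod_X_add_C_coeff s x hm
    have h := coeff_mul_coeff_le_sq hsp (s.card - (j + 2))
    rw [hc _ (by omega), hc _ (by omega), hc _ (by omega),
      show s.card - (s.card - (j + 2)) = j + 2 by omega,
      show s.card - (s.card - (j + 2) + 2) = j by omega,
      show s.card - (s.card - (j + 2) + 1) = j + 1 by omega] at h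
    linarith
  · rw [elem_of_card_lt x (not_le.1 hj)]
    nlinarith [sq_nonneg (elem s x (j + 1))]

end Newton

/-! ### Gårding cones, Marcus–Lopes and Gårding inequalities -/

section Cone

open Filter Topology

variable {ι : Type*}

/-- The open cone on which the elementary symmetric functions of degree at most `k` are
positive. -/
def posCone (s : Finset ι) (k : ℕ) : Set (ι → ℝ) := {x | ∀ j ≤ k, 0 < elem s x j}

/-- The closed cone on which the elementary symmetric functions of degree at most `k` are
nonnegative. -/
def nonnegCone (s : Finset ι) (k : ℕ) : Set (ι → ℝ) := {x | ∀ j ≤ k, 0 ≤ elem s x j}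

lemma posCone_anti (s : Finset ι) {k l : ℕ} (h : k ≤ l) : posCone s l ⊆ posCone s k :=
  fun _ hx j hj => hx j (hj.trans h)

lemma nonnegCone_anti (s : Finset ι) {k l : ℕ} (h : k ≤ l) : nonnegCone s l ⊆ nonnegCone s k :=
  fun _ hx j hj => hx j (hj.trans h)

lemma posCone_subset_nonnegCone (s : Finset ι) (k : ℕ) : posCone s k ⊆ nonnegCone s k :=
  fun _ hx j hj => (hx j hj).le

lemma smul_mem_posCone {s : Finset ι} {k : ℕ} {x : ι → ℝ} (hx : x ∈ posCone s k) {c : ℝ}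
    (hc : 0 < c) : c • x ∈ posCone s k := fun j hj => by
  rw [elem_smul]
  exact mul_pos (pow_pos hc j) (hx j hj)

lemma isClosed_nonnegCone (s : Finset ι) (k : ℕ) : IsClosed (nonnegCone s k) := by
  simp only [nonnegCone, Set.ofPred_forall]
  exact isClosed_iInter fun j => isClosed_iInter fun _ =>
    isClosed_le continuous_const (continuous_elem s j)

lemma isOpen_posCone (s : Finset ι) (k : ℕ) : IsOpen (posCone s k) := by
  have : posCone s k = ⋂ j ∈ Finset.range (k + 1), {x | 0 < elem s x j} := by
    ext x
    simp [posCone]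
  rw [this]
  exact isOpen_biInter_finset fun j _ => isOpen_lt continuous_const (continuous_elem s j)

/-- The ratio of consecutive elementary symmetric functions. -/
noncomputable def ratio (s : Finset ι) (k : ℕ) (x : ι → ℝ) : ℝ := elem s x (k + 1) / elem s x k

lemma ratio_pos {s : Finset ι} {k j : ℕ} {x : ι → ℝ} (hx : x ∈ posCone s k) (hj : j < k) :
    0 < ratio s j x :=
  div_pos (hx _ hj) (hx _ hj.le)

lemma ratio_smul (s : Finset ι) (k : ℕ) {c : ℝ} (hc : c ≠ 0) (x : ι → ℝ) :
    ratio s k (c • x) = c * ratio s k x := by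
  unfold ratio
  rw [elem_smul, elem_smul, pow_succ]
  have := pow_ne_zero k hc
  rw [mul_assoc, mul_div_mul_left _ _ this, mul_div_assoc]

lemma prod_ratio {s : Finset ι} {k : ℕ} {x : ι → ℝ} (hx : x ∈ posCone s k) :
    ∏ j ∈ Finset.range k, ratio s j x = elem s x k := by
  induction k with
  | zero => simp
  | succ k ih =>
    rw [Finset.prod_range_succ, ih (posCone_anti s k.le_succ hx), ratio,
      mul_div_cancel₀ _ (hx k k.le_succ).ne']

lemma tendsto_add_smul (x y : ι → ℝ) :
    Tendsto (fun ε : ℝ => x + ε • y) (𝓝[>] 0) (𝓝 x) := by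
  have : Continuous fun ε : ℝ => x + ε • y := by fun_prop
  simpa using (this.tendsto 0).mono_left nhdsWithin_le_nhds

variable [DecidableEq ι]

/-- Let `a, b, c` be consecutive functions of the remaining variables, with `a > 0`. If `b ≤ 0`,
then `b + x_i a > 0` and `c + x_i b > 0`, multiplied by `-b` and `a` and added, give `ac > b²`,
against Newton. -/
lemma mem_posCone_erase {s : Finset ι} {k : ℕ} {x : ι → ℝ} (hx : x ∈ posCone s (k + 1)) {i : ι}
    (hi : i ∈ s) : x ∈ posCone (s.erase i) k := by
  intro j
  induction j with
  | zero => simp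
  | succ j ih =>
    intro hj
    have ha := ih (by omega)
    have h1 := hx (j + 1) (by omega)
    have h2 := hx (j + 2) (by omega)
    rw [elem_erase hi] at h1 h2
    have hN := elem_mul_elem_le_sq (s.erase i) x j
    by_contra! hb
    have h3 := mul_pos ha h2
    have h4 := mul_nonneg (neg_nonneg.2 hb) h1.le
    nlinarith

lemma add_ratio_pos {s : Finset ι} {k : ℕ} {x : ι → ℝ} (hx : x ∈ posCone s (k + 1)) {i : ι}
    (hi : i ∈ s) : 0 < x i + ratio (s.erase i) k x := by
  have h1 := hx (k + 1) le_rfl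
  have h2 := mem_posCone_erase hx hi k le_rfl
  rw [elem_erase hi] at h1
  have : x i + ratio (s.erase i) k x =
      (elem (s.erase i) x (k + 1) + x i * elem (s.erase i) x k) / elem (s.erase i) x k := by
    unfold ratio
    field_simp
    ring
  rw [this]
  exact div_pos h1 h2

/-- Euler's identity, with each term rewritten by deleting `i`. It expresses a ratio through ratios
of one degree less in one variable less, which drives the induction for Marcus–Lopes. -/
lemma mul_ratio_succ {s : Finset ι} {k : ℕ} {x : ι → ℝ} (hx : x ∈ posCone s (k + 1)) :
    ((k : ℝ) + 2) * ratio s (k + 1) x =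
      ∑ i ∈ s, (x i - x i ^ 2 / (x i + ratio (s.erase i) k x)) := by
  have h : ((k : ℝ) + 2) * ratio s (k + 1) x =
      ∑ i ∈ s, x i * elem (s.erase i) x (k + 1) / elem s x (k + 1) := by
    rw [← Finset.sum_div, sum_mul_elem_erase, ratio]
    push_cast
    ring
  rw [h]
  refine Finset.sum_congr rfl fun i hi => ?_
  have h1 := hx (k + 1) le_rfl
  have h2 := mem_posCone_erase hx hi k le_rfl
  have h3 := add_ratio_pos hx hi
  have h4 : elem s x (k + 1) = elem (s.erase i) x k * (x i + ratio (s.erase i) k x) := by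
    rw [elem_erase hi, ratio]
    field_simp
    ring
  have h5 : elem (s.erase i) x (k + 1) = elem s x (k + 1) - x i * elem (s.erase i) x k := by
    rw [elem_erase hi]
    ring
  rw [h5, h4]
  field_simp

lemma sq_div_add_le {a b u v w : ℝ} (hu : 0 < u) (hv : 0 < v) (hw : u + v ≤ w) :
    (a + b) ^ 2 / w ≤ a ^ 2 / u + b ^ 2 / v := by
  calc (a + b) ^ 2 / w ≤ (a + b) ^ 2 / (u + v) := by gcongr
    _ ≤ a ^ 2 / u + b ^ 2 / v := by
      rw [div_add_div _ _ hu.ne' hv.ne', div_le_div_iff₀ (by positivity) (by positivity)]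
      have : (a ^ 2 * v + u * b ^ 2) * (u + v) - (a + b) ^ 2 * (u * v) =
          (a * v - b * u) ^ 2 := by ring
      nlinarith [sq_nonneg (a * v - b * u)]

/-- The **Marcus–Lopes inequality**: `posCone s k` is closed under addition, and on it the ratio of
consecutive elementary symmetric functions is superadditive. -/
lemma add_mem_posCone_and_ratio_add_le (k : ℕ) : ∀ (s : Finset ι) (x y : ι → ℝ),
    x ∈ posCone s k → y ∈ posCone s k →
      x + y ∈ posCone s k ∧ ratio s k x + ratio s k y ≤ ratio s k (x + y) := by
  induction k with
  | zero =>
    intro s x y _ _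
    refine ⟨fun j hj => ?_, ?_⟩
    · rw [Nat.le_zero.1 hj]
      simp
    · simp [ratio, elem_one, Finset.sum_add_distrib]
  | succ k ih =>
    intro s x y hx hy
    obtain ⟨h1, h2⟩ := ih s x y (posCone_anti s k.le_succ hx) (posCone_anti s k.le_succ hy)
    -- Only the top degree is new: superadditivity one level down makes the ratio at `x + y`
    -- positive.
    have hmem : x + y ∈ posCone s (k + 1) := by
      intro j hj
      rcases hj.lt_or_eq with hj | rfl
      · exact h1 j (by omega)
      · have h3 : 0 < ratio s k (x + y) :=
          (add_pos (ratio_pos hx k.lt_succ_self) (ratio_pos hy k.lt_succ_self)).trans_le h2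
        have h4 := mul_pos h3 (h1 k le_rfl)
        rwa [ratio, div_mul_cancel₀ _ (h1 k le_rfl).ne'] at h4
    refine ⟨hmem, ?_⟩
    have hk : (0 : ℝ) < k + 2 := by positivity
    refine le_of_mul_le_mul_left ?_ hk
    rw [mul_add, mul_ratio_succ hx, mul_ratio_succ hy, mul_ratio_succ hmem,
      ← Finset.sum_add_distrib]
    refine Finset.sum_le_sum fun i hi => ?_
    have h5 := (ih (s.erase i) x y (mem_posCone_erase hx hi) (mem_posCone_erase hy hi)).2
    have h6 := sq_div_add_le (a := x i) (b := y i) (add_ratio_pos hx hi) (add_ratio_pos hy hi)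
      (w := (x + y) i + ratio (s.erase i) k (x + y)) (by simp only [Pi.add_apply]; linarith)
    simp only [Pi.add_apply] at h6 ⊢
    linarith

lemma nonneg_of_hasDerivAt {f : ℝ → ℝ} {d : ℝ} (hf : HasDerivAt f d 0) (h0 : f 0 = 0)
    (hpos : ∀ t, 0 < t → 0 ≤ f t) : 0 ≤ d := by
  have h := (hasDerivWithinAt_iff_tendsto_slope' (s := Set.Ioi (0 : ℝ)) (by simp)).1
    (hf.hasDerivWithinAt (s := Set.Ioi 0))
  refine ge_of_tendsto h ?_
  filter_upwards [self_mem_nhdsWithin] with t ht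
  rw [slope_def_field, h0]
  exact div_nonneg (by simpa using hpos t ht) (by simpa using (Set.mem_Ioi.1 ht).le)

lemma one_add_sum_le_prod_one_add {κ : Type*} (s : Finset κ) {f : κ → ℝ}
    (hf : ∀ i ∈ s, 0 ≤ f i) : 1 + ∑ i ∈ s, f i ≤ ∏ i ∈ s, (1 + f i) := by
  classical
  induction s using Finset.induction_on with
  | empty => simp
  | insert a s ha ih =>
    rw [Finset.sum_insert ha, Finset.prod_insert ha]
    have h1 := hf a (Finset.mem_insert_self a s)
    have h2 : 0 ≤ ∑ i ∈ s, f i := Finset.sum_nonneg fun i hi => hf i (Finset.mem_insert_of_mem hi)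
    have h3 := ih fun i hi => hf i (Finset.mem_insert_of_mem hi)
    nlinarith [mul_nonneg h1 h2]

/-- **Gårding's inequality** for the elementary symmetric functions. -/
lemma garding_of_mem_posCone {s : Finset ι} {k : ℕ} {x y : ι → ℝ} (hx : x ∈ posCone s (k + 1))
    (hy : y ∈ posCone s (k + 1)) :
    ((k : ℝ) + 1) * elem s x (k + 1) *
        (elem s y (k + 1) / elem s x (k + 1)) ^ (1 / ((k : ℝ) + 1)) ≤
      ∑ i ∈ s, y i * elem (s.erase i) x k := by
  set r : ℕ → ℝ := fun j => ratio s j y / ratio s j x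
  have hr : ∀ j ∈ Finset.range (k + 1), 0 < r j := fun j hj =>
    div_pos (ratio_pos hy (Finset.mem_range.1 hj)) (ratio_pos hx (Finset.mem_range.1 hj))
  have hex := hx (k + 1) le_rfl
  -- Factor into ratios, apply superadditivity to each, and keep only the terms up to first order in
  -- `t`. Both sides agree at `t = 0`, so their derivatives there compare.
  have hlow : ∀ t : ℝ, 0 < t → elem s x (k + 1) * (1 + t * ∑ j ∈ Finset.range (k + 1), r j) ≤
      elem s (x + t • y) (k + 1) := by
    intro t ht
    have hty := smul_mem_posCone hy ht
    have hxy := (add_mem_posCone_and_ratio_add_le (k + 1) s x (t • y) hx hty).1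
    calc elem s x (k + 1) * (1 + t * ∑ j ∈ Finset.range (k + 1), r j)
        ≤ elem s x (k + 1) * ∏ j ∈ Finset.range (k + 1), (1 + t * r j) := by
          rw [Finset.mul_sum]
          exact mul_le_mul_of_nonneg_left (one_add_sum_le_prod_one_add _ fun j hj =>
            (mul_pos ht (hr j hj)).le) hex.le
      _ = ∏ j ∈ Finset.range (k + 1), (ratio s j x + ratio s j (t • y)) := by
          rw [← prod_ratio hx, ← Finset.prod_mul_distrib]
          refine Finset.prod_congr rfl fun j hj => ?_
          have := (ratio_pos hx (Finset.mem_range.1 hj)).ne'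
          rw [ratio_smul s j ht.ne']
          simp only [r]
          field_simp
      _ ≤ ∏ j ∈ Finset.range (k + 1), ratio s j (x + t • y) := by
          refine Finset.prod_le_prod (fun j hj => ?_) fun j hj => ?_
          · exact (add_pos (ratio_pos hx (Finset.mem_range.1 hj))
              (ratio_pos hty (Finset.mem_range.1 hj))).le
          · have hj' := (Finset.mem_range.1 hj).le
            exact (add_mem_posCone_and_ratio_add_le j s x (t • y) (posCone_anti s hj' hx)
              (posCone_anti s hj' hty)).2
      _ = _ := prod_ratio hxy
  have hd : elem s x (k + 1) * ∑ j ∈ Finset.range (k + 1), r j ≤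
      ∑ i ∈ s, y i * elem (s.erase i) x k := by
    have h1 := hasDerivAt_elem s x y k 0
    have h2 : HasDerivAt (fun t : ℝ => elem s x (k + 1) *
        (1 + t * ∑ j ∈ Finset.range (k + 1), r j))
        (elem s x (k + 1) * ∑ j ∈ Finset.range (k + 1), r j) 0 := by
      simpa using (((hasDerivAt_id (0 : ℝ)).mul_const
        (∑ j ∈ Finset.range (k + 1), r j)).const_add 1).const_mul (elem s x (k + 1))
    have h3 := nonneg_of_hasDerivAt (h1.sub h2) (by simp) fun t ht => by
      simpa using hlow t ht
    simpa using h3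
  refine le_trans ?_ hd
  have hamgm := Real.geom_mean_le_arith_mean (Finset.range (k + 1)) (fun _ => (1 : ℝ)) r
    (fun _ _ => zero_le_one) (by simp; positivity) fun j hj => (hr j hj).le
  have hprod : ∏ j ∈ Finset.range (k + 1), r j = elem s y (k + 1) / elem s x (k + 1) := by
    simp only [r, Finset.prod_div_distrib]
    rw [prod_ratio hx, prod_ratio hy]
  simp only [Real.rpow_one, one_mul, Finset.sum_const, Finset.card_range, nsmul_eq_mul, mul_one,
    hprod] at hamgm
  push_cast at hamgm
  rw [le_div_iff₀ (by positivity), ← one_div] at hamgm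
  calc _ = elem s x (k + 1) * ((elem s y (k + 1) / elem s x (k + 1)) ^ (1 / ((k : ℝ) + 1)) *
        ((k : ℝ) + 1)) := by ring
    _ ≤ _ := mul_le_mul_of_nonneg_left hamgm hex.le

/-- Induction on the degree: along `(1,…,1)` the function of degree `j + 1` has derivative `s.card -
j` times that of degree `j`, so it increases strictly from a nonnegative value. -/
lemma add_smul_one_mem_posCone {s : Finset ι} {k : ℕ} (hk : k ≤ s.card) {x : ι → ℝ}
    (hx : x ∈ nonnegCone s k) {ε : ℝ} (hε : 0 < ε) :
    x + ε • (fun _ => (1 : ℝ)) ∈ posCone s k := by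
  suffices ∀ j ≤ k, ∀ t : ℝ, 0 < t → 0 < elem s (x + t • (fun _ => (1 : ℝ))) j from
    fun j hj => this j hj ε hε
  intro j
  induction j with
  | zero => simp
  | succ j ih =>
    intro hj t ht
    have hmono : StrictMonoOn (fun t : ℝ => elem s (x + t • (fun _ => (1 : ℝ))) (j + 1))
        (Set.Ici 0) := by
      refine strictMonoOn_of_deriv_pos (convex_Ici 0) ?_ fun t ht => ?_
      · exact fun t _ => (hasDerivAt_elem s x _ j t).continuousAt.continuousWithinAt
      · rw [(hasDerivAt_elem s x _ j t).deriv]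
        simp only [one_mul]
        rw [sum_elem_erase]
        rw [interior_Ici] at ht
        refine mul_pos (sub_pos.2 ?_) (ih (by omega) t ht)
        exact_mod_cast (show j < s.card by omega)
    have h := hmono (Set.mem_Ici.2 le_rfl) (Set.mem_Ici.2 ht.le) ht
    have h0 := hx (j + 1) hj
    simp only [zero_smul, add_zero] at h
    exact h0.trans_lt h

lemma closure_posCone {s : Finset ι} {k : ℕ} (hk : k ≤ s.card) :
    closure (posCone s k) = nonnegCone s k := by
  refine (closure_minimal (posCone_subset_nonnegCone s k) (isClosed_nonnegCone s k)).antisymm ?_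
  intro x hx
  refine mem_closure_of_tendsto (tendsto_add_smul x fun _ => 1) ?_
  filter_upwards [self_mem_nhdsWithin] with ε hε
  exact add_smul_one_mem_posCone hk hx hε

lemma mem_nonnegCone_erase {s : Finset ι} {k : ℕ} (hk : k + 1 ≤ s.card) {x : ι → ℝ}
    (hx : x ∈ nonnegCone s (k + 1)) {i : ι} (hi : i ∈ s) : x ∈ nonnegCone (s.erase i) k := by
  refine (isClosed_nonnegCone _ _).mem_of_tendsto (tendsto_add_smul x fun _ => 1) ?_
  filter_upwards [self_mem_nhdsWithin] with ε hε
  exact posCone_subset_nonnegCone _ _ (mem_posCone_erase (add_smul_one_mem_posCone hk hx hε) hi)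

/-- Gårding's inequality, up to the boundary in the second argument. -/
lemma garding {s : Finset ι} {k : ℕ} (hk : k + 1 ≤ s.card) {x y : ι → ℝ}
    (hx : x ∈ posCone s (k + 1)) (hy : y ∈ nonnegCone s (k + 1)) :
    ((k : ℝ) + 1) * elem s x (k + 1) *
        (elem s y (k + 1) / elem s x (k + 1)) ^ (1 / ((k : ℝ) + 1)) ≤
      ∑ i ∈ s, y i * elem (s.erase i) x k := by
  rw [← closure_posCone hk] at hy
  have hcl : IsClosed {y : ι → ℝ | ((k : ℝ) + 1) * elem s x (k + 1) *
        (elem s y (k + 1) / elem s x (k + 1)) ^ (1 / ((k : ℝ) + 1)) ≤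
      ∑ i ∈ s, y i * elem (s.erase i) x k} := by
    refine isClosed_le (continuous_const.mul (Continuous.rpow_const ?_ fun _ => Or.inr ?_)) ?_
    · exact (continuous_elem s _).div_const _
    · positivity
    · fun_prop
  exact closure_minimal (fun y hy => garding_of_mem_posCone hx hy) hcl hy

end Cone

/-! ### Boundary points, separation and near-optimal vectors -/

section Boundary

open Filter Topology

variable {ι : Type*} [DecidableEq ι]

lemma elem_erase_eq_zero {s : Finset ι} {k : ℕ} (hk : k + 1 ≤ s.card) {x : ι → ℝ}
    (hx : x ∈ nonnegCone s (k + 1)) {j : ℕ} (hj : j ≤ k) (h : elem s x j = 0) {i : ι}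
    (hi : i ∈ s) : elem (s.erase i) x j = 0 := by
  have hsum := sum_elem_erase s x j
  rw [h, mul_zero, Finset.sum_eq_zero_iff_of_nonneg fun i hi =>
    mem_nonnegCone_erase hk hx hi j hj] at hsum
  exact hsum i hi

/-- A zero in some degree propagates upward: all deletions vanish in that degree, and Euler's
identity gives zero in the next. Hence the top-degree function vanishes at every boundary point. -/
lemma mem_posCone_of_elem_pos {s : Finset ι} {k : ℕ} (hk : k ≤ s.card) {x : ι → ℝ}
    (hx : x ∈ nonnegCone s k) (h : 0 < elem s x k) : x ∈ posCone s k := by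
  intro j hj
  refine (hx j hj).lt_of_ne' fun h0 => h.ne' ?_
  obtain ⟨l, rfl⟩ := Nat.exists_eq_add_of_le hj
  clear h
  induction l with
  | zero => exact h0
  | succ l ih =>
    have h1 := ih (by omega) (nonnegCone_anti s (by omega) hx) (by omega)
    have h2 := sum_mul_elem_erase s x (j + l)
    rw [Finset.sum_eq_zero fun i hi => by
      rw [elem_erase_eq_zero (k := j + l) hk hx le_rfl h1 hi, mul_zero]] at h2
    rcases mul_eq_zero.1 h2.symm with h3 | h3
    · have : (0 : ℝ) < ((j + l : ℕ) : ℝ) + 1 := by positivity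
      linarith
    · exact h3

/-- A boundary point at which two consecutive elementary symmetric functions vanish has many
vanishing entries. -/
lemma card_lt_add_card_zeros (k : ℕ) : ∀ (s : Finset ι) (x : ι → ℝ), k + 1 ≤ s.card →
    x ∈ nonnegCone s (k + 1) → elem s x (k + 1) = 0 → elem s x k = 0 →
      s.card < k + (s.filter fun i => x i = 0).card := by
  induction k with
  | zero => simp
  | succ k ih =>
    intro s x hk hx _ h1
    by_cases hall : ∀ i ∈ s, x i = 0
    · rw [Finset.filter_true_of_mem hall]
      omega
    -- Deleting a nonzero entry preserves the hypotheses one degree lower and does not change the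
    -- number of zeros.
    · push Not at hall
      obtain ⟨i, hi, hxi⟩ := hall
      have h2 := elem_erase_eq_zero hk hx le_rfl h1 hi
      have h3 := elem_erase hi x k
      rw [h1, h2, zero_add] at h3
      have h4 := (mul_eq_zero.1 h3.symm).resolve_left hxi
      have hc := Finset.card_erase_of_mem hi
      have h5 := ih (s.erase i) x (by omega) (mem_nonnegCone_erase hk hx hi) h2 h4
      have h6 : ((s.erase i).filter fun i => x i = 0).card ≤ (s.filter fun i => x i = 0).card :=
        Finset.card_le_card (Finset.filter_subset_filter _ (Finset.erase_subset i s))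
      omega

lemma elem_pos_of_zeros_subsingleton {s : Finset ι} {k : ℕ} (hk : k + 1 ≤ s.card) {x : ι → ℝ}
    (hx : x ∈ nonnegCone s (k + 1)) (h : elem s x (k + 1) = 0)
    (hz : ∀ i ∈ s, ∀ j ∈ s, x i = 0 → x j = 0 → i = j) : 0 < elem s x k := by
  refine (hx k k.le_succ).lt_of_ne' fun h0 => ?_
  have h1 := card_lt_add_card_zeros k s x hk hx h h0
  have h2 : (s.filter fun i => x i = 0).card ≤ 1 := by
    refine Finset.card_le_one.2 fun i hi j hj => ?_
    rw [Finset.mem_filter] at hi hj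
    exact hz i hi.1 j hj.1 hi.2 hj.2
  omega

omit [DecidableEq ι] in
lemma mem_posCone_of_pos {s : Finset ι} {k : ℕ} (hk : k ≤ s.card) {p : ι → ℝ}
    (hp : ∀ i, 0 < p i) : p ∈ posCone s k := by
  intro j hj
  refine Finset.sum_pos (fun t _ => Finset.prod_pos fun i _ => hp i) ?_
  exact Finset.powersetCard_nonempty.2 (hj.trans hk)

/-- A vector outside the closed cone is separated from it by the tangent hyperplane at some
boundary point. -/
lemma exists_boundary_separating {n k : ℕ} (hk : k + 1 ≤ n) {y : Fin n → ℝ}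
    (hy : y ∉ nonnegCone (univ : Finset (Fin n)) (k + 1)) :
    ∃ x ∈ nonnegCone (univ : Finset (Fin n)) (k + 1), elem univ x (k + 1) = 0 ∧
      ∑ i, y i * elem (univ.erase i) x k < 0 := by
  have hcard : k + 1 ≤ (univ : Finset (Fin n)).card := by simpa using hk
  -- The distinct weights `i + 1` make the coordinates of the segment from `p` to `y` vanish at
  -- distinct times. So the exit point from the cone has at most one zero entry, and its function of
  -- degree `k` is positive.
  set p : Fin n → ℝ := fun i => if y i = 0 then 1 else ((i : ℕ) + 1) * |y i| with hpdef
  have hp : ∀ i, 0 < p i := by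
    intro i
    simp only [hpdef]
    split_ifs with h
    · exact one_pos
    · have := abs_pos.2 h
      positivity
  have hpc : p ∈ posCone (univ : Finset (Fin n)) (k + 1) := mem_posCone_of_pos hcard hp
  set c : ℝ → Fin n → ℝ := fun t => p + t • (y - p) with hc
  have hcc : Continuous c := by fun_prop
  set S : Set ℝ := Set.Icc 0 1 ∩ c ⁻¹' nonnegCone univ (k + 1) with hS
  have hScl : IsCompact S :=
    isCompact_Icc.inter_right ((isClosed_nonnegCone _ _).preimage hcc)
  have h0S : (0 : ℝ) ∈ S := by
    refine ⟨by simp, ?_⟩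
    simpa [hc] using posCone_subset_nonnegCone _ _ hpc
  set t := sSup S
  have htS : t ∈ S := hScl.sSup_mem ⟨0, h0S⟩
  have ht1 : t < 1 := by
    refine htS.1.2.lt_of_ne fun h => hy ?_
    have := htS.2
    rw [h] at this
    simpa [hc] using this
  have hbd : c t ∉ posCone univ (k + 1) := by
    intro hpos
    have hev : ∀ᶠ r in 𝓝[>] t, c r ∈ posCone univ (k + 1) :=
      (hcc.continuousAt.eventually_mem ((isOpen_posCone _ _).mem_nhds hpos)).filter_mono
        nhdsWithin_le_nhds
    have hev1 : ∀ᶠ r in 𝓝[>] t, r < 1 :=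
      (eventually_lt_nhds ht1).filter_mono nhdsWithin_le_nhds
    obtain ⟨r, ⟨hr, hr1⟩, hrt⟩ := ((hev.and hev1).and self_mem_nhdsWithin).exists
    have hrt' : t < r := hrt
    have : r ∈ S := ⟨⟨htS.1.1.trans hrt'.le, hr1.le⟩, posCone_subset_nonnegCone _ _ hr⟩
    exact (le_csSup hScl.bddAbove this).not_gt hrt'
  have ht0 : 0 < t := by
    refine htS.1.1.lt_of_ne fun h => hbd ?_
    rw [← h]
    simpa [hc] using hpc
  have hct : ∀ i, c t i = (1 - t) * p i + t * y i := fun i => by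
    simp only [hc, Pi.add_apply, Pi.smul_apply, Pi.sub_apply, smul_eq_mul]
    ring
  have hzero : elem univ (c t) (k + 1) = 0 := by
    by_contra h
    exact hbd (mem_posCone_of_elem_pos hcard htS.2
      ((htS.2 (k + 1) le_rfl).lt_of_ne' h))
  have hz : ∀ i, c t i = 0 → (1 - t) * ((i : ℕ) + 1) = t := by
    intro i hi
    rw [hct] at hi
    have hpos := mul_pos (sub_pos.2 ht1) (hp i)
    have hneg : y i < 0 := by
      by_contra! h
      have := mul_nonneg ht0.le h
      linarith
    simp only [hpdef, if_neg hneg.ne, abs_of_neg hneg] at hi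
    have : y i * (t - (1 - t) * ((i : ℕ) + 1)) = 0 := by linarith
    have := (mul_eq_zero.1 this).resolve_left hneg.ne
    linarith
  have hek : 0 < elem univ (c t) k := by
    refine elem_pos_of_zeros_subsingleton hcard htS.2 hzero fun i _ j _ hi hj => ?_
    have h1 := (hz i hi).trans (hz j hj).symm
    have h2 := mul_left_cancel₀ (sub_pos.2 ht1).ne' h1
    exact Fin.ext (by exact_mod_cast add_right_cancel h2)
  refine ⟨c t, htS.2, hzero, ?_⟩
  have hnn : ∀ i ∈ (univ : Finset (Fin n)), 0 ≤ elem (univ.erase i) (c t) k := fun i hi =>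
    mem_nonnegCone_erase hcard htS.2 hi k le_rfl
  have hsum : 0 < ∑ i, p i * elem (univ.erase i) (c t) k := by
    have h1 : 0 < ∑ i, elem (univ.erase i) (c t) k := by
      rw [sum_elem_erase]
      refine mul_pos (sub_pos.2 ?_) hek
      exact_mod_cast (show k < _ by omega)
    obtain ⟨i, hi, h2⟩ := Finset.exists_lt_of_sum_lt (s := univ) (f := fun _ : Fin n => (0 : ℝ))
      (by simpa using h1)
    exact Finset.sum_pos' (fun i hi => mul_nonneg (hp i).le (hnn i hi)) ⟨i, hi, mul_pos (hp i) h2⟩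
  -- By Euler the pairing with `c t = (1 - t)p + ty` is zero; the pairing with `p` is positive, so
  -- that with `y` is negative.
  have htot := sum_mul_elem_erase univ (c t) k
  rw [hzero, mul_zero] at htot
  have hsplit : ∑ i, c t i * elem (univ.erase i) (c t) k =
      (1 - t) * ∑ i, p i * elem (univ.erase i) (c t) k +
        t * ∑ i, y i * elem (univ.erase i) (c t) k := by
    rw [Finset.mul_sum, Finset.mul_sum, ← Finset.sum_add_distrib]
    refine Finset.sum_congr rfl fun i _ => ?_
    rw [hct i]
    ring
  rw [hsplit] at htot
  have h3 := mul_pos (sub_pos.2 ht1) hsum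
  by_contra! h4
  have := mul_nonneg ht0.le h4
  linarith

/-- The factor which scales a vector `x` to one with `elem s · (k + 1) = 1`. -/
noncomputable def scale (s : Finset ι) (k : ℕ) (x : ι → ℝ) : ℝ :=
  (elem s x (k + 1))⁻¹ ^ (1 / ((k : ℝ) + 1))

omit [DecidableEq ι] in
lemma scale_pos {s : Finset ι} {k : ℕ} {x : ι → ℝ} (hx : x ∈ posCone s (k + 1)) :
    0 < scale s k x :=
  Real.rpow_pos_of_pos (inv_pos.2 (hx _ le_rfl)) _

omit [DecidableEq ι] in
lemma elem_scale_smul {s : Finset ι} {k : ℕ} {x : ι → ℝ} (hx : x ∈ posCone s (k + 1)) :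
    elem s (scale s k x • x) (k + 1) = 1 := by
  have h := hx _ le_rfl
  rw [elem_smul, scale, ← Real.rpow_natCast, ← Real.rpow_mul (inv_pos.2 h).le]
  push_cast
  rw [one_div_mul_cancel (by positivity), Real.rpow_one, inv_mul_cancel₀ h.ne']

lemma sum_mul_elem_erase_smul (s : Finset ι) (k : ℕ) (x y : ι → ℝ) (c : ℝ) :
    ∑ i ∈ s, y i * elem (s.erase i) (c • x) k = c ^ k * ∑ i ∈ s, y i * elem (s.erase i) x k := by
  rw [Finset.mul_sum]
  refine Finset.sum_congr rfl fun i _ => ?_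
  rw [elem_smul]
  ring

lemma exists_sum_lt_of_notMem {n k : ℕ} (hk1 : 1 ≤ k) (hk : k + 1 ≤ n) {y : Fin n → ℝ}
    (hy : y ∉ nonnegCone (univ : Finset (Fin n)) (k + 1)) (C : ℝ) :
    ∃ x ∈ posCone (univ : Finset (Fin n)) (k + 1), elem univ x (k + 1) = 1 ∧
      ∑ i, y i * elem (univ.erase i) x k < C := by
  have hcard : k + 1 ≤ (univ : Finset (Fin n)).card := by simpa using hk
  obtain ⟨x, hx, hx0, hneg⟩ := exists_boundary_separating hk hy
  have hlim := tendsto_add_smul x fun _ => (1 : ℝ)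
  have hpos : ∀ᶠ ε : ℝ in 𝓝[>] 0,
      x + ε • (fun _ => (1 : ℝ)) ∈ posCone (univ : Finset (Fin n)) (k + 1) := by
    filter_upwards [self_mem_nhdsWithin] with ε hε
    exact add_smul_one_mem_posCone hcard hx hε
  have hE : Tendsto (fun ε : ℝ => elem univ (x + ε • (fun _ => (1 : ℝ))) (k + 1)) (𝓝[>] 0)
      (𝓝[>] 0) := by
    refine tendsto_nhdsWithin_iff.2 ⟨?_, hpos.mono fun ε h => h _ le_rfl⟩
    have := ((continuous_elem univ (k + 1)).tendsto x).comp hlim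
    rwa [hx0] at this
  -- Here `1 ≤ k` is essential: for `k = 0` the pairing is `∑ y_i`, whatever the scaling.
  have hscale : Tendsto (fun ε : ℝ => scale univ k (x + ε • (fun _ => (1 : ℝ))) ^ k) (𝓝[>] 0)
      atTop :=
    (tendsto_pow_atTop (by omega)).comp ((tendsto_rpow_atTop (by positivity)).comp
      (tendsto_inv_nhdsGT_zero.comp hE))
  have hcont : Continuous fun x : Fin n → ℝ => ∑ i, y i * elem (univ.erase i) x k :=
    continuous_finsetSum _ fun i _ => continuous_const.mul (continuous_elem _ k)
  have hbot := hscale.atTop_mul_neg hneg ((hcont.tendsto x).comp hlim)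
  obtain ⟨ε, h1, h2⟩ := ((hbot.eventually_lt_atBot C).and hpos).exists
  refine ⟨_, smul_mem_posCone h2 (scale_pos h2), elem_scale_smul h2, ?_⟩
  rw [sum_mul_elem_erase_smul]
  exact h1

/-- The witness is a multiple of `x = y + ε(1,…,1)`, since `y` itself may lie on the boundary. As `y
≤ x` and the coefficients are positive, the pairing is at most its Euler value at `x`, and
continuity absorbs `ε`. -/
lemma exists_sum_lt_of_mem {s : Finset ι} {k : ℕ} (hk : k + 1 ≤ s.card) {y : ι → ℝ}
    (hy : y ∈ nonnegCone s (k + 1)) {C : ℝ}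
    (hC : ((k : ℝ) + 1) * elem s y (k + 1) ^ (1 / ((k : ℝ) + 1)) < C) :
    ∃ x ∈ posCone s (k + 1), elem s x (k + 1) = 1 ∧
      ∑ i ∈ s, y i * elem (s.erase i) x k < C := by
  have hcont : Continuous fun y : ι → ℝ =>
      ((k : ℝ) + 1) * elem s y (k + 1) ^ (1 / ((k : ℝ) + 1)) :=
    continuous_const.mul ((continuous_elem s _).rpow_const fun _ => Or.inr (by positivity))
  have hlim := (hcont.tendsto y).comp (tendsto_add_smul y fun _ => (1 : ℝ))
  obtain ⟨ε, h1, hε⟩ := ((hlim.eventually_lt_const hC).and self_mem_nhdsWithin).exists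
  have hε : 0 < ε := hε
  simp only [Function.comp_apply] at h1
  set x := y + ε • fun _ => (1 : ℝ) with hxdef
  have hx : x ∈ posCone s (k + 1) := add_smul_one_mem_posCone hk hy hε
  have hsc := scale_pos hx
  refine ⟨_, smul_mem_posCone hx hsc, elem_scale_smul hx, ?_⟩
  rw [sum_mul_elem_erase_smul]
  refine lt_of_le_of_lt ?_ h1
  have hE := hx _ le_rfl
  have hle : ∑ i ∈ s, y i * elem (s.erase i) x k ≤ ((k : ℝ) + 1) * elem s x (k + 1) := by
    rw [← sum_mul_elem_erase]
    refine Finset.sum_le_sum fun i hi => mul_le_mul_of_nonneg_right ?_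
      (mem_posCone_erase hx hi k le_rfl).le
    simp [hxdef, hε.le]
  have hinv : scale s k x * elem s x (k + 1) ^ (1 / ((k : ℝ) + 1)) = 1 := by
    rw [scale, Real.inv_rpow hE.le, inv_mul_cancel₀ (Real.rpow_pos_of_pos hE _).ne']
  have h1' := elem_scale_smul hx
  rw [elem_smul, pow_succ] at h1'
  have : scale s k x ^ k * elem s x (k + 1) = elem s x (k + 1) ^ (1 / ((k : ℝ) + 1)) := by
    refine mul_left_cancel₀ hsc.ne' ?_
    rw [hinv]
    linarith
  calc _ ≤ scale s k x ^ k * (((k : ℝ) + 1) * elem s x (k + 1)) := by gcongr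
    _ = _ := by rw [← this]; ring

end Boundary

/-! ### Traces, eigenvalues and doubly stochastic matrices -/

section Spectral

lemma exists_perm_of_map_eq {ι α : Type*} [Fintype ι] [DecidableEq α] {f g : ι → α}
    (h : (univ : Finset ι).val.map f = (univ : Finset ι).val.map g) :
    ∃ π : Equiv.Perm ι, ∀ i, g (π i) = f i := by
  have hcard : ∀ a, Nonempty ({i // f i = a} ≃ {i // g i = a}) := fun a => by
    refine ⟨Fintype.equivOfCardEq ?_⟩
    have := congrArg (Multiset.count a) h
    rw [Multiset.count_map, Multiset.count_map] at this
    rw [Fintype.card_subtype, Fintype.card_subtype]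
    simp only [eq_comm (a := a)] at this
    exact this
  exact ⟨Equiv.ofFiberEquiv fun a => (hcard a).some, fun i => Equiv.ofFiberEquiv_map _ i⟩

variable {n : Type*} [Fintype n] [DecidableEq n]

/-- **Birkhoff's theorem** as a rearrangement principle. -/
lemma le_sum_of_mem_doublyStochastic {a b : n → ℝ} {c : ℝ}
    (h : ∀ π : Equiv.Perm n, c ≤ ∑ i, a i * b (π i)) {P : Matrix n n ℝ}
    (hP : P ∈ doublyStochastic ℝ n) : c ≤ ∑ i, ∑ j, P i j * (a i * b j) := by
  have hlin : IsLinearMap ℝ fun P : Matrix n n ℝ => ∑ i, ∑ j, P i j * (a i * b j) :=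
    ⟨fun P Q => by simp [add_mul, Finset.sum_add_distrib],
      fun r P => by simp [Finset.mul_sum, mul_assoc]⟩
  have hconv := convex_halfSpace_ge hlin c
  rw [← SetLike.mem_coe, doublyStochastic_eq_convexHull_permMatrix] at hP
  refine convexHull_min ?_ hconv hP
  rintro _ ⟨π, rfl⟩
  simpa [PEquiv.toMatrix_apply, Finset.sum_ite_eq, ite_mul] using h π

lemma sq_entries_mem_doublyStochastic {W : Matrix n n ℝ} (hW : W ∈ Matrix.unitaryGroup n ℝ) :
    Matrix.of (fun i j => W i j ^ 2) ∈ doublyStochastic ℝ n := by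
  rw [mem_doublyStochastic_iff_sum]
  refine ⟨fun i j => sq_nonneg _, fun i => ?_, fun j => ?_⟩
  · have := congrFun (congrFun (Matrix.mem_unitaryGroup_iff.1 hW) i) i
    simpa [Matrix.mul_apply, sq] using this
  · have := congrFun (congrFun (Matrix.mem_unitaryGroup_iff'.1 hW) j) j
    simpa [Matrix.mul_apply, sq] using this

lemma trace_diagonal_mul_conj (a b : n → ℝ) (W : Matrix n n ℝ) :
    (Matrix.diagonal a * (W * Matrix.diagonal b * star W)).trace =
      ∑ i, ∑ j, W i j ^ 2 * (a i * b j) := by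
  simp only [Matrix.trace, Matrix.diag_apply, Matrix.diagonal_mul]
  refine Finset.sum_congr rfl fun i _ => ?_
  rw [Matrix.mul_apply, Finset.mul_sum]
  refine Finset.sum_congr rfl fun j _ => ?_
  simp [Matrix.mul_diagonal]
  ring

lemma isHermitian_eq_conj {M : Matrix n n ℝ} (hM : M.IsHermitian) :
    M = (hM.eigenvectorUnitary : Matrix n n ℝ) * Matrix.diagonal hM.eigenvalues *
      star (hM.eigenvectorUnitary : Matrix n n ℝ) := by
  conv_lhs => rw [hM.spectral_theorem, Unitary.conjStarAlgAut_apply]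
  rfl

/-- The trace of `Aᵀ M A` in terms of the eigenvalues of `M` and `A`. -/
lemma exists_doublyStochastic_trace {M A : Matrix n n ℝ} (hM : M.IsHermitian)
    (hA : A.IsHermitian) : ∃ P ∈ doublyStochastic ℝ n,
      (A.transpose * M * A).trace =
        ∑ i, ∑ j, P i j * (hM.eigenvalues i * hA.eigenvalues j ^ 2) := by
  set V := hM.eigenvectorUnitary
  set U := hA.eigenvectorUnitary
  have hVV : star (V : Matrix n n ℝ) * V = 1 := Unitary.coe_star_mul_self V
  have hUU : star (U : Matrix n n ℝ) * U = 1 := Unitary.coe_star_mul_self U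
  -- The weights are the squared inner products between the two eigenbases.
  refine ⟨_, sq_entries_mem_doublyStochastic (star V * U).2, ?_⟩
  have hAt : A.transpose = A := by simpa using hA.eq
  have hAA : A * A = U * Matrix.diagonal (fun i => hA.eigenvalues i ^ 2) *
      star (U : Matrix n n ℝ) := by
    conv_lhs => rw [isHermitian_eq_conj hA]
    calc _ = U * Matrix.diagonal hA.eigenvalues * (star (U : Matrix n n ℝ) * U) *
          Matrix.diagonal hA.eigenvalues * star (U : Matrix n n ℝ) := by
          simp only [U, Matrix.mul_assoc]
      _ = _ := by
          rw [hUU, Matrix.mul_one, Matrix.mul_assoc (U : Matrix n n ℝ), Matrix.diagonal_mul_diagonal]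
          simp only [sq]
  have htr : (A.transpose * M * A).trace = (M * (A * A)).trace := by
    rw [hAt, Matrix.trace_mul_comm, ← Matrix.mul_assoc, Matrix.trace_mul_comm]
  rw [htr, hAA]
  conv_lhs => rw [isHermitian_eq_conj hM]
  have := trace_diagonal_mul_conj hM.eigenvalues (fun i => hA.eigenvalues i ^ 2)
    ((star V * U : Matrix.unitaryGroup n ℝ) : Matrix n n ℝ)
  simp only [Matrix.of_apply]
  rw [← this]
  rw [Matrix.mul_assoc, Matrix.mul_assoc, Matrix.trace_mul_comm]
  simp [V, U, Matrix.mul_assoc, StarMul.star_mul]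

/-- For every vector `b` of nonnegative numbers there is a positive semidefinite matrix with these
eigenvalues which is diagonal in an eigenbasis of `M`. -/
lemma exists_posSemidef_trace {M : Matrix n n ℝ} (hM : M.IsHermitian) {b : n → ℝ}
    (hb : ∀ i, 0 ≤ b i) : ∃ (A : Matrix n n ℝ) (hA : A.PosSemidef) (π : Equiv.Perm n),
      (∀ i, b (π i) = hA.isHermitian.eigenvalues i) ∧
        (A.transpose * M * A).trace = ∑ i, hM.eigenvalues i * b i ^ 2 := by
  set V := hM.eigenvectorUnitary
  have hVV : star (V : Matrix n n ℝ) * V = 1 := Unitary.coe_star_mul_self V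
  set A : Matrix n n ℝ := V * Matrix.diagonal b * star (V : Matrix n n ℝ) with hAdef
  have hA : A.PosSemidef :=
    (Matrix.posSemidef_diagonal_iff.2 hb).mul_mul_conjTranspose_same (V : Matrix n n ℝ)
  have hchar : A.charpoly = ∏ i, (X - C (b i)) := by
    rw [hAdef, Matrix.charpoly_mul_comm, ← Matrix.mul_assoc, hVV, Matrix.one_mul,
      Matrix.charpoly_diagonal]
  have hroots : A.charpoly.roots = univ.val.map b := by
    rw [hchar, Polynomial.roots_prod]
    · simp
    · simp [Finset.prod_ne_zero_iff, Polynomial.X_sub_C_ne_zero]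
  have h := hA.isHermitian.roots_charpoly_eq_eigenvalues
  rw [hroots] at h
  -- The characteristic polynomial determines the eigenvalues only as a multiset, so their given
  -- enumeration matches `b` up to a permutation.
  obtain ⟨π, hπ⟩ := exists_perm_of_map_eq h.symm
  refine ⟨A, hA, π, fun i => hπ i, ?_⟩
  have hAt : A.transpose = A := by simpa using hA.isHermitian.eq
  rw [hAt]
  have hMA : A * M * A = V * Matrix.diagonal (fun i => b i * hM.eigenvalues i * b i) *
      star (V : Matrix n n ℝ) := by
    conv_lhs => rw [isHermitian_eq_conj hM]
    calc _ = V * Matrix.diagonal b * (star (V : Matrix n n ℝ) * V) *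
          Matrix.diagonal hM.eigenvalues * (star (V : Matrix n n ℝ) * V) *
            Matrix.diagonal b * star (V : Matrix n n ℝ) := by
          simp only [hAdef, V, Matrix.mul_assoc]
      _ = _ := by
          rw [hVV, Matrix.mul_one, Matrix.mul_one, Matrix.mul_assoc (V : Matrix n n ℝ),
            Matrix.mul_assoc (V : Matrix n n ℝ), Matrix.diagonal_mul_diagonal,
            Matrix.diagonal_mul_diagonal]
  rw [hMA, Matrix.trace_mul_comm, ← Matrix.mul_assoc, hVV, Matrix.one_mul, Matrix.trace_diagonal]
  exact Finset.sum_congr rfl fun i _ => by ring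

end Spectral

/-! ### Evaluation of the infimum -/

section Operator

variable {n : ℕ}

lemma sigma_eq_elem (k : ℕ) (γ : Fin n → ℝ) : sigma k γ = elem univ γ k := by
  simp [sigma, MvPolynomial.esymm, elem]

lemma sigmaOmit_eq_elem (k : ℕ) (i : Fin n) (γ : Fin n → ℝ) :
    sigmaOmit k i γ = elem (univ.erase i) γ k := by
  rw [sigmaOmit, sigma_eq_elem]
  have hcongr : elem (univ.erase i) (Function.update γ i 0) k = elem (univ.erase i) γ k := by
    refine Finset.sum_congr rfl fun t ht => Finset.prod_congr rfl fun j hj => ?_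
    exact Function.update_of_ne
      (Finset.ne_of_mem_erase ((Finset.mem_powersetCard.1 ht).1 hj)) _ _
  rw [← hcongr]
  cases k with
  | zero => simp
  | succ k => simp [elem_erase (Finset.mem_univ i)]

lemma gardingCone_eq_posCone (n k : ℕ) : gardingCone n k = posCone univ k := by
  ext γ
  simp only [gardingCone, posCone, Set.mem_ofPred_eq, sigma_eq_elem]
  refine ⟨fun h j hj => ?_, fun h j _ hj => h j hj⟩
  rcases Nat.eq_zero_or_pos j with rfl | h0
  · simp
  · exact h j h0 hj

lemma closure_gardingCone {k : ℕ} (hk : k ≤ n) :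
    closure (gardingCone n k) = nonnegCone univ k := by
  rw [gardingCone_eq_posCone, closure_posCone (by simpa using hk)]

lemma mem_closure_gardingCone_iff {k : ℕ} (hk : k ≤ n) {γ : Fin n → ℝ} :
    γ ∈ closure (gardingCone n k) ↔ ∀ j : ℕ, 1 ≤ j → j ≤ k → 0 ≤ sigma j γ := by
  rw [closure_gardingCone hk]
  simp only [nonnegCone, Set.mem_ofPred_eq, sigma_eq_elem]
  refine ⟨fun h j _ hj => h j hj, fun h j hj => ?_⟩
  rcases Nat.eq_zero_or_pos j with rfl | h0
  · simp
  · exact h j h0 hj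

lemma elem_univ_comp_perm (π : Equiv.Perm (Fin n)) (γ : Fin n → ℝ) (k : ℕ) :
    elem univ (γ ∘ π) k = elem univ γ k := by
  have := elem_map π.toEmbedding univ γ k
  rw [Finset.map_univ_equiv] at this
  exact this.symm

lemma elem_erase_comp_perm (π : Equiv.Perm (Fin n)) (γ : Fin n → ℝ) (k : ℕ) (i : Fin n) :
    elem (univ.erase i) (γ ∘ π) k = elem (univ.erase (π i)) γ k := by
  have := elem_map π.toEmbedding (univ.erase i) γ k
  rw [Finset.map_erase, Finset.map_univ_equiv] at this
  exact this.symm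

lemma comp_perm_mem_posCone {k : ℕ} {γ : Fin n → ℝ} (hγ : γ ∈ posCone univ k)
    (π : Equiv.Perm (Fin n)) : γ ∘ π ∈ posCone univ k := fun j hj => by
  rw [elem_univ_comp_perm]
  exact hγ j hj

lemma infOp_lt_of_mem_posCone {k : ℕ} {M : Matrix (Fin n) (Fin n) ℝ} (hM : M.IsHermitian)
    {γ : Fin n → ℝ} (hγ : γ ∈ posCone univ (k + 1)) (h1 : elem univ γ (k + 1) = 1) {C : ℝ}
    (hC : ∑ i, hM.eigenvalues i * elem (univ.erase i) γ k < C) :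
    infOp (coeffSet n (k + 1)) M < C := by
  have hpos : ∀ i, 0 ≤ elem (univ.erase i) γ k := fun i =>
    (mem_posCone_erase hγ (mem_univ i) k le_rfl).le
  obtain ⟨A, hA, π, hπ, htr⟩ := exists_posSemidef_trace hM
    (b := fun i => √(elem (univ.erase i) γ k)) fun i => Real.sqrt_nonneg _
  have hmem : A ∈ coeffSet n (k + 1) := by
    -- Composing `γ` with `π` undoes the reordering of the eigenvalues of `A`.
    refine ⟨hA, γ ∘ π, ?_, ?_, fun i => ?_⟩
    · rw [gardingCone_eq_posCone]
      exact comp_perm_mem_posCone hγ π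
    · rw [sigma_eq_elem, elem_univ_comp_perm, h1]
    · rw [← hπ i, Real.sq_sqrt (hpos _), sigmaOmit_eq_elem, Nat.add_sub_cancel,
        elem_erase_comp_perm]
  refine (iInf₂_le A hmem).trans_lt ?_
  simp only [Real.sq_sqrt (hpos _)] at htr
  rw [htr]
  exact_mod_cast hC

lemma le_infOp {k : ℕ} (hk : k + 1 ≤ n) {M : Matrix (Fin n) (Fin n) ℝ} (hM : M.IsHermitian)
    (hmem : hM.eigenvalues ∈ nonnegCone univ (k + 1)) :
    ((((k : ℝ) + 1) * elem univ hM.eigenvalues (k + 1) ^ (1 / ((k : ℝ) + 1)) : ℝ) : EReal) ≤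
      infOp (coeffSet n (k + 1)) M := by
  refine le_iInf₂ fun A hA => ?_
  obtain ⟨hA, γ, hγ, h1, heig⟩ := hA
  rw [gardingCone_eq_posCone] at hγ
  rw [sigma_eq_elem] at h1
  simp only [sigmaOmit_eq_elem, Nat.add_sub_cancel] at heig
  obtain ⟨P, hP, htr⟩ := exists_doublyStochastic_trace hM hA.isHermitian
  rw [htr, EReal.coe_le_coe_iff]
  -- At a permutation matrix the sum is the pairing of `λ(M)` with the coefficients of `γ ∘ π`, so
  -- Gårding's inequality applies.
  refine le_sum_of_mem_doublyStochastic (fun π => ?_) hP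
  have h := garding (by simpa using hk) (comp_perm_mem_posCone hγ π) hmem
  simp only [elem_univ_comp_perm, h1, mul_one, div_one, elem_erase_comp_perm] at h
  simpa only [heig] using h

lemma infOp_eq_of_mem {k : ℕ} (hk : k + 1 ≤ n) {M : Matrix (Fin n) (Fin n) ℝ}
    (hM : M.IsHermitian) (hmem : hM.eigenvalues ∈ nonnegCone univ (k + 1)) :
    infOp (coeffSet n (k + 1)) M =
      ((((k : ℝ) + 1) * elem univ hM.eigenvalues (k + 1) ^ (1 / ((k : ℝ) + 1)) : ℝ) : EReal) := by
  refine le_antisymm (EReal.le_of_forall_lt_iff_le.1 fun C hC => ?_) (le_infOp hk hM hmem)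
  obtain ⟨γ, hγ, h1, h2⟩ := exists_sum_lt_of_mem (by simpa using hk) hmem
    (EReal.coe_lt_coe_iff.1 hC)
  exact (infOp_lt_of_mem_posCone hM hγ h1 h2).le

lemma infOp_eq_bot_of_notMem {k : ℕ} (hk1 : 1 ≤ k) (hk : k + 1 ≤ n)
    {M : Matrix (Fin n) (Fin n) ℝ} (hM : M.IsHermitian)
    (hmem : hM.eigenvalues ∉ nonnegCone univ (k + 1)) : infOp (coeffSet n (k + 1)) M = ⊥ := by
  refine (EReal.eq_bot_iff_forall_lt _).2 fun C => ?_
  obtain ⟨γ, hγ, h1, h2⟩ := exists_sum_lt_of_notMem hk1 hk hmem C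
  exact infOp_lt_of_mem_posCone hM hγ h1 h2

end Operator

end

end KHessian

/-! ### The formula, the finiteness cone and `k`-convexity -/

theorem lemma6p3 (n k : ℕ) (hk : 2 ≤ k) (hkn : k ≤ n) :
    (∀ (M : Matrix (Fin n) (Fin n) ℝ) (hM : M.IsHermitian),
      (hM.eigenvalues ∈ closure (KHessian.gardingCone n k) →
        KHessian.infOp (KHessian.coeffSet n k) M
          = (((k : ℝ) * (KHessian.sigma k hM.eigenvalues) ^ (1 / (k : ℝ)) : ℝ) : EReal)) ∧
      (hM.eigenvalues ∉ closure (KHessian.gardingCone n k) →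
        KHessian.infOp (KHessian.coeffSet n k) M = ⊥)) ∧
    KHessian.finiteCone (KHessian.coeffSet n k) = KHessian.closedConeMat n k ∧
    (∀ (Ω : Set (EuclideanSpace ℝ (Fin n))) (u : EuclideanSpace ℝ (Fin n) → ℝ),
      IsOpen Ω → ContDiffOn ℝ 2 u Ω →
      (KHessian.KConvex k Ω u ↔ KHessian.Admissible (KHessian.coeffSet n k) Ω u)) := by
  have hinf : ∀ (M : Matrix (Fin n) (Fin n) ℝ) (hM : M.IsHermitian),
      (hM.eigenvalues ∈ closure (KHessian.gardingCone n k) →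
        KHessian.infOp (KHessian.coeffSet n k) M
          = (((k : ℝ) * (KHessian.sigma k hM.eigenvalues) ^ (1 / (k : ℝ)) : ℝ) : EReal)) ∧
      (hM.eigenvalues ∉ closure (KHessian.gardingCone n k) →
        KHessian.infOp (KHessian.coeffSet n k) M = ⊥) := by
    intro M hM
    obtain ⟨m, rfl⟩ : ∃ m, k = m + 1 := ⟨k - 1, by omega⟩
    rw [KHessian.closure_gardingCone hkn, KHessian.sigma_eq_elem]
    push_cast
    exact ⟨KHessian.infOp_eq_of_mem hkn hM,
      KHessian.infOp_eq_bot_of_notMem (by omega) hkn hM⟩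
  have hcone : KHessian.finiteCone (KHessian.coeffSet n k) = KHessian.closedConeMat n k := by
    ext M
    refine ⟨fun ⟨hM, hlt⟩ => ⟨hM, ?_⟩, fun ⟨hM, hmem⟩ => ⟨hM, ?_⟩⟩
    · by_contra h
      exact hlt.ne' ((hinf M hM).2 h)
    · rw [(hinf M hM).1 hmem]
      exact EReal.bot_lt_coe _
  refine ⟨hinf, hcone, fun Ω u _ _ => ?_⟩
  -- Both notions are pointwise conditions on the Hessian, and they coincide because the closed cone
  -- is cut out by the weak inequalities.
  simp only [KHessian.KConvex, KHessian.Admissible, hcone, KHessian.closedConeMat,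
    Set.mem_ofPred_eq, KHessian.mem_closure_gardingCone_iff hkn]
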